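/- All graphs are finite, simple and have at least one vertex. A graph is claw-free if it has no induced subgraph isomorphic to $K_{1,3}$. A decomposition of $G=(V,E)$ into $2$-regular subgraphs and edges is a partition of $E$ into nonempty sets $E_1,\dots,E_k$ such that each $E_i$ either consists of a single edge or has the property that the subgraph $(V(E_i),E_i)$ is $2$-regular, where $V(E_i)$ is the set of vertices incident to an edge of $E_i$ (so the $2$-regular subgraphs need be neither spanning nor connected). Let $\mathrm{re}(G)$ be the minimum number $k$ of parts in such a decomposition. Theorem. If $G$ is a claw-free graph on $n$ vertices, then $\mathrm{re}(G)\le n-1$. -/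

import Mathlib

namespace SimpleGraph

variable {V : Type*}

/-- `G` is claw-free: no induced subgraph of `G` is isomorphic to the claw `K_{1,3}`. -/
def IsClawFree (G : SimpleGraph V) : Prop :=
  ¬ (completeBipartiteGraph (Fin 1) (Fin 3)).IsIndContained G

/-- The subgraph `(V(E), E)` of `G` spanned by a set `E` of edges of `G`: its vertices are exactly
the vertices incident to an edge of `E`. -/
def spannedBy (G : SimpleGraph V) (E : Set (Sym2 V)) : G.Subgraph where
  verts := {v | ∃ w, G.Adj v w ∧ s(v, w) ∈ E}
  Adj v w := G.Adj v w ∧ s(v, w) ∈ E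
  adj_sub h := h.1
  edge_vert h := ⟨_, h⟩
  symm := ⟨fun v w h => ⟨h.1.symm, Sym2.eq_swap (a := v) (b := w) ▸ h.2⟩⟩

/-- A subgraph is 2-regular if each of its vertices has exactly two neighbours in it. It need be
neither spanning nor connected. -/
def Subgraph.IsTwoRegular {G : SimpleGraph V} (H : G.Subgraph) : Prop :=
  ∀ v ∈ H.verts, (H.neighborSet v).ncard = 2

/-- A partition of the edge set of `G` (all parts nonempty) is a decomposition of `G` into
2-regular subgraphs and edges if each part is a single edge or spans a 2-regular subgraph. -/
def IsTwoRegularEdgeDecomposition (G : SimpleGraph V) (P : Finpartition G.edgeSet) : Prop :=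
  ∀ E ∈ P.parts, (G.spannedBy E).IsTwoRegular ∨ ∃ e, E = {e}

/-- `re(G)`: the minimum number of subgraphs in a decomposition of `G` into 2-regular subgraphs
and edges. -/
noncomputable def re (G : SimpleGraph V) : ℕ :=
  sInf {k | ∃ P : Finpartition G.edgeSet, G.IsTwoRegularEdgeDecomposition P ∧ P.parts.card = k}

/-- A finite graph always has such a decomposition (into single edges), so the minimum defining
`re(G)` is over a nonempty set and is attained. -/
theorem exists_twoRegularEdgeDecomposition_card_eq_re [Finite V] (G : SimpleGraph V) :
    ∃ P : Finpartition G.edgeSet, G.IsTwoRegularEdgeDecomposition P ∧ P.parts.card = G.re := by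
  let S : Finset (Set (Sym2 V)) :=
    (Set.toFinite G.edgeSet).toFinset.map ⟨fun e => {e}, Set.singleton_injective⟩
  have hdisj : (S : Set (Set (Sym2 V))).PairwiseDisjoint id := by
    intro A hA B hB hAB
    simp only [S, Finset.coe_map, Function.Embedding.coeFn_mk, Set.mem_image] at hA hB
    obtain ⟨a, -, rfl⟩ := hA
    obtain ⟨b, -, rfl⟩ := hB
    exact Set.disjoint_singleton.2 fun h => hAB (by rw [h])
  let P : Finpartition G.edgeSet :=
    { parts := S
      supIndep := Finset.supIndep_iff_pairwiseDisjoint.2 hdisj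
      sup_parts := by
        ext e
        simp [S, Finset.sup_eq_iSup]
      bot_notMem := by simp [S] }
  refine Nat.sInf_mem (s := {k | ∃ P : Finpartition G.edgeSet,
    G.IsTwoRegularEdgeDecomposition P ∧ P.parts.card = k}) ⟨_, P, ?_, rfl⟩
  intro E hE
  obtain ⟨e, -, rfl⟩ := Finset.mem_map.1 hE
  exact Or.inr ⟨e, rfl⟩

end SimpleGraph

namespace SimpleGraph

open Finset

variable {V : Type*}

/-! Among the subgraphs `F ≤ G` for which all degrees of `G \ F` are even, choose one with fewest
edges. Switching `F` along a closed trail preserves the parity condition, so `F` contains at most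
half of the edges of every closed trail (`exists_isHalfBounded`). In particular `F` is a forest,
with at most `n - c` edges, where `c` is its number of components.

The even graph `G \ F`, of maximum degree `2k`, splits into at most `k` 2-regular subgraphs, as in
Petersen's theorem (`exists_twoRegular_coloring`). Taking the edges of `F` singly gives `re(G) ≤ n -
c + k`, so `k ≤ c - 1` suffices.

Claw-freeness enters only here. The neighbours of `v` in `G \ F` avoid the component of `v` in `F`;
each other component holds at most two of them, except possibly one that holds three. Hence `2k ≤
2(c - 1) + 1`, and parity removes the extra one. -/

/-! ### Permutation matrices and counting in forests -/

/-- A nonnegative integer matrix with all row and column sums equal to `k` is a sum of `k`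
permutation matrices. -/
theorem exists_perm_of_sum_eq [Fintype V] [DecidableEq V] (k : ℕ) (m : V → V → ℕ)
    (hr : ∀ u, ∑ t, m u t = k) (hc : ∀ t, ∑ u, m u t = k) :
    ∃ σ : Fin k → Equiv.Perm V, ∀ u t, m u t = #{i | σ i u = t} := by
  induction k generalizing m with
  | zero =>
    refine ⟨Fin.elim0, fun u t => ?_⟩
    have := Finset.sum_eq_zero_iff.1 (hr u) t (mem_univ _)
    simp [this]
  | succ k ih =>
    obtain ⟨τ, hτ⟩ : ∃ τ : Equiv.Perm V, ∀ u, 0 < m u (τ u) := by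
      -- Scaling makes `m` doubly stochastic; any permutation of positive weight in its Birkhoff
      -- decomposition lies in the support of `m`.
      let M : Matrix V V ℚ := fun u t => (m u t : ℚ) / (k + 1)
      have hk : (0 : ℚ) < k + 1 := by positivity
      have hM : M ∈ doublyStochastic ℚ V := by
        rw [mem_doublyStochastic_iff_sum]
        refine ⟨fun i j => by positivity, fun i => ?_, fun j => ?_⟩
        · simp only [M]
          rw [← Finset.sum_div, ← Nat.cast_sum, hr]
          push_cast; exact div_self hk.ne'
        · simp only [M]
          rw [← Finset.sum_div, ← Nat.cast_sum, hc]
          push_cast; exact div_self hk.ne'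
      obtain ⟨w, hw0, hw1, hwM⟩ := exists_eq_sum_perm_of_mem_doublyStochastic hM
      obtain ⟨τ, -, hτ⟩ : ∃ τ ∈ (univ : Finset (Equiv.Perm V)), 0 < w τ := by
        refine Finset.exists_lt_of_sum_lt ?_
        simp [hw1]
      refine ⟨τ, fun u => ?_⟩
      have h1 : 0 < M u (τ u) := by
        rw [← hwM, Matrix.sum_apply]
        refine Finset.sum_pos' (fun σ _ => ?_) ⟨τ, mem_univ _, ?_⟩
        · rw [Matrix.smul_apply, Equiv.Perm.permMatrix, PEquiv.toMatrix_apply, smul_eq_mul]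
          exact mul_nonneg (hw0 _) (by split_ifs <;> norm_num)
        · simpa [Matrix.smul_apply, Equiv.Perm.permMatrix, PEquiv.toMatrix_apply] using hτ
      have h2 : (0 : ℚ) < m u (τ u) := by
        have := mul_pos h1 hk
        rwa [div_mul_cancel₀ _ hk.ne'] at this
      exact_mod_cast h2
    have key : ∀ u t, m u t = (m u t - if τ u = t then 1 else 0) + if τ u = t then 1 else 0 := by
      intro u t
      split_ifs with h
      · subst h; have := hτ u; omega
      · simp
    obtain ⟨σ, hσ⟩ := ih (fun u t => m u t - if τ u = t then 1 else 0)
      (fun u => by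
        have h := hr u
        rw [Finset.sum_congr rfl fun t _ => key u t, Finset.sum_add_distrib] at h
        simpa using h)
      (fun t => by
        have h := hc t
        rw [Finset.sum_congr rfl fun u _ => key u t, Finset.sum_add_distrib] at h
        have h1 : ∑ u, (if τ u = t then 1 else 0) = 1 := by
          simp [← Equiv.eq_symm_apply]
        omega)
    refine ⟨Fin.cons τ σ, fun u t => ?_⟩
    rw [key u t, hσ u t, add_comm]
    simp only [Finset.card_filter, Fin.sum_univ_succ, Fin.cons_zero, Fin.cons_succ]

/-- Every edge of a forest is a bridge, so deleting it creates a new component. -/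
theorem IsAcyclic.card_edgeSet_add_card_connectedComponent_le [Fintype V]
    (F : SimpleGraph V) (hF : F.IsAcyclic) :
    Nat.card F.edgeSet + Nat.card F.ConnectedComponent ≤ Fintype.card V := by
  classical
  induction h : Nat.card F.edgeSet generalizing F with
  | zero =>
    rw [zero_add, ← Nat.card_eq_fintype_card]
    exact Nat.card_le_card_of_surjective F.connectedComponentMk (Quot.mk_surjective)
  | succ k ih =>
    have hne : Nonempty F.edgeSet := by
      by_contra hne
      rw [not_nonempty_iff] at hne
      simp at h
    obtain ⟨⟨e, he⟩⟩ := hne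
    induction e with | _ u v
    have hb := isAcyclic_iff_forall_isBridge.1 hF he
    have hle : F.deleteEdges {s(u, v)} ≤ F := deleteEdges_le _
    have hcard : Nat.card (F.deleteEdges {s(u, v)}).edgeSet = k := by
      rw [edgeSet_deleteEdges, Nat.card_coe_set_eq, Set.ncard_sdiff_singleton_of_mem he,
        ← Nat.card_coe_set_eq, h]; rfl
    have h1 := ih _ (hF.anti hle) hcard
    have h2 : Nat.card F.ConnectedComponent
        < Nat.card (F.deleteEdges {s(u, v)}).ConnectedComponent := by
      simp only [Nat.card_eq_fintype_card]
      refine Fintype.card_lt_of_surjective_not_injective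
        (ConnectedComponent.map (Hom.ofLE hle)) ?_ ?_
      · intro c
        induction c using ConnectedComponent.ind with | _ w
        exact ⟨connectedComponentMk _ w, rfl⟩
      · intro hinj
        have : (F.deleteEdges {s(u, v)}).connectedComponentMk u = connectedComponentMk _ v := by
          apply hinj
          exact ConnectedComponent.eq.2 (Adj.reachable he)
        rw [ConnectedComponent.eq] at this
        exact (isBridge_iff.1 hb) this
    omega

/-! ### Even graphs and balanced orientations -/

/-- In a forest, an end of a longest path has degree 1. -/
theorem not_isAcyclic_of_even_degree [Fintype V] (H : SimpleGraph V) [DecidableRel H.Adj]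
    (hH : ∀ v, Even (H.degree v)) (hne : H ≠ ⊥) : ¬ H.IsAcyclic := by
  intro hac
  obtain ⟨a, b, hab⟩ : ∃ a b, H.Adj a b := by
    by_contra! h
    exact hne (by ext a b; simpa using h a b)
  have : Nonempty V := ⟨a⟩
  obtain ⟨u, v, p, hp, hmax⟩ := Walk.exists_isPath_forall_isPath_length_le_length H
  have hlen : 1 ≤ p.length := hmax a b hab.toWalk (by simp [Walk.isPath_def, hab.ne])
  have hnil : ¬ p.Nil := by rw [← Walk.length_eq_zero_iff]; omega
  have hall : ∀ w, H.Adj u w → w = p.snd := by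
    intro w hw
    refine hac.eq_snd_of_adj_start hp hw ?_
    by_contra hws
    have := hmax w v (Walk.cons hw.symm p) (hp.cons hws)
    simp at this
  have hdeg : H.degree u = 1 := by
    rw [← card_neighborFinset_eq_degree, Finset.card_eq_one]
    refine ⟨p.snd, ?_⟩
    ext w
    rw [mem_neighborFinset, mem_singleton]
    exact ⟨hall w, fun h => h ▸ p.adj_snd hnil⟩
  have := hH u
  rw [hdeg] at this
  exact absurd this (by decide)

/-- A graph all of whose degrees are even has an orientation in which the in-degree of each vertex
equals its out-degree. -/
theorem exists_balanced_orientation [Fintype V] [DecidableEq V] (H : SimpleGraph V)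
    (hH : ∀ v, Even (H.neighborSet v).ncard) :
    ∃ D : V → V → Prop, (∀ u v, H.Adj u v ↔ D u v ∨ D v u) ∧ (∀ u v, D u v → ¬ D v u) ∧
      ∀ v, {w | D v w}.ncard = {w | D w v}.ncard := by
  classical
  induction h : H.edgeSet.ncard using Nat.strong_induction_on generalizing H with
  | _ n ih =>
    by_cases hb : H = ⊥
    · subst hb
      exact ⟨fun _ _ => False, by simp, by simp, by simp⟩
    have hnac := not_isAcyclic_of_even_degree H (fun v => by
      rw [← card_neighborFinset_eq_degree, ← Set.ncard_coe_finset, coe_neighborFinset]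
      exact hH v) hb
    obtain ⟨u, c, hc⟩ : ∃ (u : V) (c : H.Walk u u), c.IsCycle := by
      simpa [IsAcyclic] using hnac
    -- The cycle is oriented along its direction of travel; the rest of `H` is still even and is
    -- oriented by induction.
    let C : V → V → Prop := fun a b => ∃ d ∈ c.darts, d.fst = a ∧ d.snd = b
    have hCe : ∀ a b, s(a, b) ∈ c.edges ↔ C a b ∨ C b a := by
      intro a b
      simp only [Walk.edges, List.mem_map, C]
      constructor
      · rintro ⟨d, hd, h⟩
        rcases dart_edge_eq_mk'_iff.1 h with h | h
        · exact Or.inl ⟨d, hd, congrArg Prod.fst h, congrArg Prod.snd h⟩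
        · exact Or.inr ⟨d, hd, congrArg Prod.fst h, congrArg Prod.snd h⟩
      · rintro (⟨d, hd, rfl, rfl⟩ | ⟨d, hd, rfl, rfl⟩)
        · exact ⟨d, hd, rfl⟩
        · exact ⟨d, hd, Sym2.eq_swap⟩
    have hinj : ∀ d ∈ c.darts, ∀ d' ∈ c.darts, d.edge = d'.edge → d = d' := by
      intro d hd d' hd' he
      exact List.inj_on_of_nodup_map hc.isTrail.edges_nodup hd hd' he
    have hCa : ∀ a b, C a b → ¬ C b a := by
      rintro a b ⟨d, hd, rfl, rfl⟩ ⟨d', hd', h1, h2⟩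
      have : d = d' := by
        refine hinj d hd d' hd' ?_
        exact dart_edge_eq_iff d d' |>.2 (Or.inr (by ext <;> simp [h1, h2]))
      subst this
      exact d.adj.ne h1
    have hdn : c.darts.Nodup := List.Nodup.of_map _ hc.isTrail.edges_nodup
    have hout : ∀ v, {w | C v w}.ncard = (c.darts.map (·.fst)).count v := by
      intro v
      have : {w | C v w} = (((c.darts.toFinset.filter (·.fst = v)).image (·.snd) : Finset V) :
          Set V) := by
        ext w; simp [C, and_assoc]
      rw [this, Set.ncard_coe_finset, Finset.card_image_of_injOn, List.count, List.countP_map,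
        List.countP_eq_length_filter, ← List.toFinset_card_of_nodup (hdn.filter _), List.toFinset_filter]
      · congr 1; ext; simp
      · intro d hd d' hd' h
        simp at hd hd'
        exact Dart.ext _ _ (Prod.ext (hd.2.trans hd'.2.symm) h)
    have hin : ∀ v, {w | C w v}.ncard = (c.darts.map (·.snd)).count v := by
      intro v
      have : {w | C w v} = (((c.darts.toFinset.filter (·.snd = v)).image (·.fst) : Finset V) :
          Set V) := by
        ext w; simp only [C, Set.mem_ofPred_eq, coe_image, Set.mem_image, mem_coe, mem_filter, List.mem_toFinset]
        exact exists_congr fun d => by tauto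
      rw [this, Set.ncard_coe_finset, Finset.card_image_of_injOn, List.count, List.countP_map,
        List.countP_eq_length_filter, ← List.toFinset_card_of_nodup (hdn.filter _), List.toFinset_filter]
      · congr 1; ext; simp
      · intro d hd d' hd' h
        simp at hd hd'
        exact Dart.ext _ _ (Prod.ext h (hd.2.trans hd'.2.symm))
    have hCb : ∀ v, {w | C v w}.ncard = {w | C w v}.ncard := by
      intro v
      rw [hout, hin]
      -- Start followed by heads, and tails followed by end, both list the support; start and end
      -- are the same vertex `u`.
      have h1 := congrArg (List.count v) (c.cons_map_snd_darts.trans c.map_fst_darts_append.symm)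
      rw [List.count_cons, List.count_append] at h1
      simp only [List.count_singleton] at h1
      omega
    clear_value C
    let H' := H.deleteEdges {e | e ∈ c.edges}
    have hH'adj : ∀ a b, H'.Adj a b ↔ H.Adj a b ∧ ¬ (C a b ∨ C b a) := by
      intro a b; simp [H', deleteEdges_adj, hCe]
    have hsub : ∀ a b, (C a b ∨ C b a) → H.Adj a b := fun a b h =>
      c.adj_of_mem_edges ((hCe a b).2 h)
    have hsplit : ∀ v, H.neighborSet v = H'.neighborSet v ∪ ({w | C v w} ∪ {w | C w v}) := by
      intro v; ext w
      simp only [mem_neighborSet, Set.mem_union, Set.mem_ofPred_eq, hH'adj]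
      have := hsub v w; tauto
    have hH' : ∀ v, Even (H'.neighborSet v).ncard := by
      intro v
      have h0 := hH v
      rw [hsplit v, Set.ncard_union_eq _ (Set.toFinite _) (Set.toFinite _),
        Set.ncard_union_eq _ (Set.toFinite _) (Set.toFinite _), hCb v] at h0
      · rw [Nat.even_add] at h0
        exact h0.2 ⟨_, rfl⟩
      · exact Set.disjoint_left.2 fun w h1 h2 => hCa _ _ h1 h2
      · refine Set.disjoint_left.2 fun w h1 h2 => ?_
        rw [mem_neighborSet, hH'adj] at h1
        exact h1.2 h2
    have hlt : H'.edgeSet.ncard < n := by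
      rw [← h]
      refine Set.ncard_lt_ncard ?_ (Set.toFinite _)
      rw [edgeSet_ssubset_edgeSet]
      refine lt_of_le_of_ne (deleteEdges_le _) fun he => ?_
      have hcn := hc.not_nil
      have h1 : H'.Adj u c.snd := by rw [he]; exact c.adj_snd hcn
      rw [deleteEdges_adj] at h1
      exact h1.2 (c.mk_start_snd_mem_edges hcn)
    obtain ⟨D, hD1, hD2, hD3⟩ := ih _ hlt H' hH' rfl
    have hDC : ∀ a b, D a b → ¬ C a b ∧ ¬ C b a := by
      intro a b hab
      have := (hH'adj a b).1 ((hD1 a b).2 (Or.inl hab))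
      tauto
    refine ⟨fun a b => D a b ∨ C a b, fun a b => ?_, fun a b => ?_, fun v => ?_⟩
    · have h1 := hH'adj a b
      rw [hD1] at h1
      have := hsub a b; tauto
    · have := hDC a b; have := hDC b a; have := hD2 a b; have := hCa a b; tauto
    · rw [Set.ofPred_or, Set.ofPred_or, Set.ncard_union_eq _ (Set.toFinite _) (Set.toFinite _),
        Set.ncard_union_eq _ (Set.toFinite _) (Set.toFinite _), hCb v, hD3 v]
      · exact Set.disjoint_left.2 fun w h1 h2 => (hDC _ _ h1).1 h2
      · exact Set.disjoint_left.2 fun w h1 h2 => (hDC _ _ h1).1 h2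

/-! ### Claw-freeness and half-bounded subgraphs -/

theorem IsClawFree.adj_of_adj {G : SimpleGraph V} (hG : G.IsClawFree) {v a b c : V}
    (ha : G.Adj v a) (hb : G.Adj v b) (hc : G.Adj v c) (hab : a ≠ b) (hac : a ≠ c) (hbc : b ≠ c) :
    G.Adj a b ∨ G.Adj a c ∨ G.Adj b c := by
  by_contra! h
  obtain ⟨h1, h2, h3⟩ := h
  have h1' := fun h => h1 (Adj.symm h)
  have h2' := fun h => h2 (Adj.symm h)
  have h3' := fun h => h3 (Adj.symm h)
  refine hG ⟨⟨⟨Sum.elim (fun _ => v) ![a, b, c], ?_⟩, ?_⟩⟩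
  · rintro (x | x) (y | y) h
    · simpa using Subsingleton.elim x y
    · fin_cases y <;> simp at h
      · exact absurd h ha.ne
      · exact absurd h hb.ne
      · exact absurd h hc.ne
    · fin_cases x <;> simp at h
      · exact absurd h ha.ne'
      · exact absurd h hb.ne'
      · exact absurd h hc.ne'
    · fin_cases x <;> fin_cases y <;> simp_all
  · intro x y
    change G.Adj (Sum.elim (fun _ => v) ![a, b, c] x) (Sum.elim (fun _ => v) ![a, b, c] y) ↔ _
    rcases x with x | x <;> rcases y with y | y
    · simp
    · fin_cases y <;> simp [ha, hb, hc]
    · fin_cases x <;> simp [ha.symm, hb.symm, hc.symm]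
    · fin_cases x <;> fin_cases y <;> simp_all

/-- `F ≤ G` contains at most half of the edges of each closed trail of `G`. -/
def IsHalfBounded (G F : SimpleGraph V) : Prop :=
  ∀ ⦃u : V⦄ (c : G.Walk u u), c.IsTrail → 2 * {e | e ∈ c.edges ∧ e ∈ F.edgeSet}.ncard ≤ c.length

variable {G F : SimpleGraph V}

theorem IsHalfBounded.two_mul_card_le (h : IsHalfBounded G F) {u : V} (c : G.Walk u u)
    (hc : c.IsTrail) (A : Finset (Sym2 V)) (hA : ∀ e ∈ A, e ∈ c.edges ∧ e ∈ F.edgeSet) :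
    2 * #A ≤ c.length := by
  refine le_trans ?_ (h c hc)
  rw [← Set.ncard_coe_finset]
  have : {e | e ∈ c.edges ∧ e ∈ F.edgeSet}.Finite :=
    c.edges.finite_toSet.subset fun e he => he.1
  exact Nat.mul_le_mul_left 2 (Set.ncard_le_ncard hA this)

/-- The two trails are edge-disjoint and close up to a trail of `G` whose edges in `F` are those of
`p`. -/
theorem IsHalfBounded.length_le (h : IsHalfBounded G F) (hF : F ≤ G) {u w : V} (p : F.Walk u w)
    (hp : p.IsTrail) (q : (G \ F).Walk w u) (hq : q.IsTrail) : p.length ≤ q.length := by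
  classical
  let c : G.Walk u u := (p.mapLe hF).append (q.mapLe sdiff_le)
  have hc : c.IsTrail := by
    rw [Walk.isTrail_append]
    refine ⟨hp.mapLe _, hq.mapLe _, ?_⟩
    rw [Walk.edges_mapLe_eq_edges, Walk.edges_mapLe_eq_edges]
    intro e he he'
    have h1 := p.edges_subset_edgeSet he
    have h2 := q.edges_subset_edgeSet he'
    rw [edgeSet_sdiff] at h2
    exact h2.2 h1
  have h1 := h.two_mul_card_le c hc p.edges.toFinset (fun e he => by
    rw [List.mem_toFinset] at he
    refine ⟨?_, p.edges_subset_edgeSet he⟩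
    rw [Walk.edges_append, Walk.edges_mapLe_eq_edges]
    exact List.mem_append_left _ he)
  rw [List.toFinset_card_of_nodup hp.edges_nodup, Walk.length_edges, Walk.length_append] at h1
  have e1 : (p.mapLe hF).length = p.length := Walk.length_map _ _
  have e2 : (q.mapLe (sdiff_le : G \ F ≤ G)).length = q.length := Walk.length_map _ _
  omega

theorem IsHalfBounded.isAcyclic (h : IsHalfBounded G F) (hF : F ≤ G) : F.IsAcyclic := by
  intro u c hc
  have := h.length_le hF c hc.isTrail Walk.nil (by simp)
  have := hc.three_le_length
  simp only [Walk.length_nil] at *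
  omega

theorem IsAcyclic.not_triangle (h : F.IsAcyclic) {a b c : V} (h1 : F.Adj a b) (h2 : F.Adj b c)
    (h3 : F.Adj c a) : False := by
  refine h (Walk.cons h1 (Walk.cons h2 h3.toWalk)) ?_
  rw [Walk.isCycle_def]
  simp [Walk.isTrail_def, h1.ne, h1.ne', h2.ne, h3.ne, h3.ne']

theorem IsAcyclic.not_four_cycle (h : F.IsAcyclic) {a b c d : V} (h1 : F.Adj a b) (h2 : F.Adj b c)
    (h3 : F.Adj c d) (h4 : F.Adj d a) (hac : a ≠ c) (hbd : b ≠ d) : False := by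
  refine h (Walk.cons h1 (Walk.cons h2 (Walk.cons h3 h4.toWalk))) ?_
  rw [Walk.isCycle_def]
  simp [Walk.isTrail_def, h1.ne, h1.ne', h2.ne, h3.ne, h4.ne, h4.ne', hac, hac.symm,
    hbd]

theorem IsAcyclic.not_five_cycle (h : F.IsAcyclic) {a b c d e : V} (h1 : F.Adj a b)
    (h2 : F.Adj b c) (h3 : F.Adj c d) (h4 : F.Adj d e) (h5 : F.Adj e a) (hac : a ≠ c) (hbd : b ≠ d)
    (hce : c ≠ e) (hda : d ≠ a) (heb : e ≠ b) : False := by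
  refine h (Walk.cons h1 (Walk.cons h2 (Walk.cons h3 (Walk.cons h4 h5.toWalk)))) ?_
  rw [Walk.isCycle_def]
  simp [Walk.isTrail_def, h1.ne, h1.ne', h2.ne, h3.ne, h4.ne, h5.ne, h5.ne',
    hac, hac.symm, hbd, hce, hda, hda.symm, heb.symm]

/-- By `length_le`, a path of `F` joining the ends of an edge outside `F` would have length at most
1. -/
theorem IsHalfBounded.not_reachable (h : IsHalfBounded G F) (hF : F ≤ G) {v u : V}
    (hu : (G \ F).Adj v u) : ¬ F.Reachable v u := by
  intro hr
  obtain ⟨p, hp⟩ := hr.exists_isPath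
  have h1 := h.length_le hF p hp.isTrail hu.symm.toWalk (by simp [Walk.isTrail_def])
  simp only [Walk.length_cons, Walk.length_nil] at h1
  cases p with
  | nil => exact hu.ne rfl
  | cons h' p =>
    cases p with
    | nil => exact hu.2 h'
    | cons h'' p => simp at h1

/-- Two neighbours of `v` in `G \ F` that lie in the same component of `F` are adjacent in `F`, or
nonadjacent in `G` with a common neighbour in `F`. -/
theorem IsHalfBounded.adj_or_exists (h : IsHalfBounded G F) (hF : F ≤ G) {v u w : V}
    (hu : (G \ F).Adj v u) (hw : (G \ F).Adj v w) (hne : u ≠ w) (hr : F.Reachable u w) :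
    F.Adj u w ∨ ¬ G.Adj u w ∧ ∃ c, F.Adj u c ∧ F.Adj c w := by
  by_cases huw : F.Adj u w
  · exact Or.inl huw
  right
  refine ⟨fun hG => h.not_reachable hF (v := u) (u := w) ⟨hG, huw⟩ hr, ?_⟩
  obtain ⟨p, hp⟩ := hr.exists_isPath
  have h1 := h.length_le hF p hp.isTrail (Walk.cons hw.symm hu.toWalk)
    (by simp [Walk.isTrail_def, hne.symm, hu.ne, hw.ne'])
  simp only [Walk.length_cons, Walk.length_nil] at h1
  cases p with
  | nil => exact absurd rfl hne
  | cons h' p =>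
    cases p with
    | nil => exact absurd h' huw
    | cons h'' p =>
      cases p with
      | nil => exact ⟨_, h', h''⟩
      | cons h''' p => simp at h1

/-! ### Cherries and the degree bound -/

/-- `a`, `b`, `c` induce in `F` a path with middle vertex `b`, whose ends are nonadjacent in `G`. -/
def IsCherry (G F : SimpleGraph V) (a b c : V) : Prop :=
  F.Adj a b ∧ F.Adj b c ∧ ¬ G.Adj a c

/-- By `adj_or_exists`, every configuration other than a cherry closes a triangle or a 5-cycle in
the forest `F`. -/
theorem IsHalfBounded.cherry_of_adj (h : IsHalfBounded G F) (hF : F ≤ G) {v x y z : V}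
    (hx : (G \ F).Adj v x) (hy : (G \ F).Adj v y) (hz : (G \ F).Adj v z) (hyz : y ≠ z) (hxz : x ≠ z)
    (hry : F.Reachable x z) (hxy : F.Adj x y) : IsCherry G F x y z ∨ IsCherry G F z x y := by
  have hac := h.isAcyclic hF
  rcases h.adj_or_exists hF hy hz hyz (hxy.symm.reachable.trans hry) with h1 | ⟨h1, a, ha, ha'⟩ <;>
  rcases h.adj_or_exists hF hx hz hxz hry with h2 | ⟨h2, b, hb, hb'⟩
  · exact (hac.not_triangle hxy h1 h2.symm).elim
  · exact Or.inl ⟨hxy, h1, h2⟩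
  · exact Or.inr ⟨h2.symm, hxy, fun h => h1 h.symm⟩
  · exfalso
    by_cases hab : a = b
    · subst hab
      exact hac.not_triangle hxy ha hb.symm
    · refine hac.not_five_cycle hxy ha ha' hb'.symm hb.symm ?_ hyz hab hxz.symm ?_
      · rintro rfl; exact h2 (hF ha')
      · rintro rfl; exact h1 (hF hb')

theorem IsHalfBounded.exists_cherry (h : IsHalfBounded G F) (hF : F ≤ G) (hG : G.IsClawFree)
    {v x y z : V} (hx : (G \ F).Adj v x) (hy : (G \ F).Adj v y) (hz : (G \ F).Adj v z)
    (hxy : x ≠ y) (hyz : y ≠ z) (hxz : x ≠ z) (hr : F.Reachable x y) (hr' : F.Reachable x z) :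
    IsCherry G F x y z ∨ IsCherry G F z x y ∨ IsCherry G F x z y := by
  -- Components of `F` are induced in `G`, so the edge supplied by claw-freeness lies in `F`.
  have key : ∀ {a b}, F.Reachable a b → G.Adj a b → F.Adj a b := fun {a b} h1 h2 => by
    by_contra h3
    exact h.not_reachable hF (v := a) (u := b) ⟨h2, h3⟩ h1
  rcases hG.adj_of_adj hx.1 hy.1 hz.1 hxy hxz hyz with h1 | h1 | h1
  · have := h.cherry_of_adj hF hx hy hz hyz hxz hr' (key hr h1)
    tauto
  · have := h.cherry_of_adj hF hx hz hy hyz.symm hxy hr (key hr' h1)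
    have e : IsCherry G F y x z → IsCherry G F z x y := fun ⟨a, b, c⟩ =>
      ⟨b.symm, a.symm, fun h => c h.symm⟩
    tauto
  · have := h.cherry_of_adj hF hy hz hx hxz.symm hxy.symm hr.symm (key (hr.symm.trans hr') h1)
    have e : IsCherry G F y z x → IsCherry G F x z y := fun ⟨a, b, c⟩ =>
      ⟨b.symm, a.symm, fun h => c h.symm⟩
    tauto

/-- The neighbours of `v` in `G \ F` cannot contain cherries of two components of `F`. -/
theorem IsHalfBounded.cherry_reachable (h : IsHalfBounded G F) (hF : F ≤ G) (hG : G.IsClawFree)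
    {v a b c a' b' c' : V} (ha : (G \ F).Adj v a) (hc : (G \ F).Adj v c)
    (ha' : (G \ F).Adj v a') (hc' : (G \ F).Adj v c') (h1 : IsCherry G F a b c)
    (h2 : IsCherry G F a' b' c') (hac : a ≠ c) (hac' : a' ≠ c') : F.Reachable a a' := by
  classical
  by_contra hr
  obtain ⟨hab, hbc, hnac⟩ := h1
  obtain ⟨hab', hbc', hnac'⟩ := h2
  have rb := hab.reachable
  have rc := rb.trans hbc.reachable
  have rb' := hab'.reachable
  have rc' := rb'.trans hbc'.reachable
  have hne : ∀ {x y}, F.Reachable a x → F.Reachable a' y → x ≠ y := by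
    rintro x _ hx hy rfl
    exact hr (hx.trans hy.symm)
  have n1 := hne .rfl .rfl
  have n2 := hne .rfl rb'
  have n3 := hne .rfl rc'
  have n4 := hne rb .rfl
  have n5 := hne rb rb'
  have n6 := hne rb rc'
  have n7 := hne rc .rfl
  have n8 := hne rc rb'
  have n9 := hne rc rc'
  -- Two disjoint edges of `G` joining the ends of one cherry to those of the other would close a
  -- 6-cycle with four edges in `F`.
  have six : ∀ {p q : V}, G.Adj c p → F.Adj p b' → F.Adj b' q → G.Adj q a → p ≠ q → a ≠ p → a ≠ q →
      b ≠ p → b ≠ q → c ≠ p → c ≠ q → False := by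
    intro p q g1 g2 g3 g4 m1 m2 m3 m4 m5 m6 m7
    have := h.two_mul_card_le (u := a) (Walk.cons (hF hab) (Walk.cons (hF hbc) (Walk.cons g1
      (Walk.cons (hF g2) (Walk.cons (hF g3) g4.toWalk)))))
      (by simp [Walk.isTrail_def, hac, hac.symm, m1, m2, m2.symm, m3, m3.symm, m4,
            m5, m6, m7, n2, n2.symm, n5, n8,
            hab.ne, hab.ne', hbc.ne, g2.ne, g3.ne])
      {s(a, b), s(b, c), s(p, b'), s(b', q)}
      (by simp [hab, hbc, g2, g3])
    rw [Finset.card_insert_of_notMem, Finset.card_insert_of_notMem, Finset.card_insert_of_notMem,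
      Finset.card_singleton] at this
    · simp at this
    · simp [m1, g2.ne, g3.ne]
    · simp [n5, n8, m4, m5, m6, m7]
    · simp [hac, hab.ne, m2, m3, n2, n5, m4, m5]
  -- As `a, c` and `a', c'` are nonadjacent pairs, claw-freeness at `v` gives each of the four ends
  -- a neighbour in the other pair. A bipartite graph on 2 + 2 vertices without isolated vertices
  -- has a perfect matching, to which `six` applies.
  have q1 := hG.adj_of_adj ha.1 hc.1 ha'.1 hac n1 n7
  have q2 := hG.adj_of_adj ha.1 hc.1 hc'.1 hac n3 n9
  have q3 := hG.adj_of_adj ha.1 ha'.1 hc'.1 n1 n3 hac'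
  have q4 := hG.adj_of_adj hc.1 ha'.1 hc'.1 n7 n9 hac'
  by_cases h1 : G.Adj c a' ∧ G.Adj c' a
  · exact six h1.1 hab' hbc' h1.2 hac' n1 n3 n4 n6 n7 n9
  by_cases h2 : G.Adj c c' ∧ G.Adj a' a
  · exact six h2.1 hbc'.symm hab'.symm h2.2 hac'.symm n3 n1 n6 n4 n9 n7
  rw [G.adj_comm c' a] at h1
  rw [G.adj_comm a' a] at h2
  tauto

theorem IsHalfBounded.ncard_neighborSet_lt_two_mul_card_connectedComponent [Fintype V] (h : IsHalfBounded G F) (hF : F ≤ G)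
    (hG : G.IsClawFree) (v : V) :
    ((G \ F).neighborSet v).ncard + 1 ≤ 2 * Nat.card F.ConnectedComponent := by
  classical
  have hac := h.isAcyclic hF
  set N : Finset V := univ.filter fun w => (G \ F).Adj v w with hN
  have hmem : ∀ {w}, w ∈ N ↔ (G \ F).Adj v w := by simp [hN]
  have hNc : ((G \ F).neighborSet v).ncard = #N := by
    rw [← Set.ncard_coe_finset]; congr 1; ext; simp [hN]
  let K := F.connectedComponentMk
  have three : ∀ k, 2 < #{w ∈ N | K w = k} → ∃ a b c, IsCherry G F a b c ∧ a ∈ N ∧ b ∈ N ∧ c ∈ N ∧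
      a ≠ c ∧ K a = k ∧ K b = k ∧ K c = k := by
    intro k hk
    obtain ⟨x, hx, y, hy, z, hz, hxy, hxz, hyz⟩ := Finset.two_lt_card.1 hk
    rw [mem_filter] at hx hy hz
    rcases h.exists_cherry hF hG (hmem.1 hx.1) (hmem.1 hy.1) (hmem.1 hz.1) hxy hyz hxz
      (ConnectedComponent.eq.1 (hx.2.trans hy.2.symm))
      (ConnectedComponent.eq.1 (hx.2.trans hz.2.symm)) with h1 | h1 | h1
    · exact ⟨_, _, _, h1, hx.1, hy.1, hz.1, hxz, hx.2, hy.2, hz.2⟩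
    · exact ⟨_, _, _, h1, hz.1, hx.1, hy.1, hyz.symm, hz.2, hx.2, hy.2⟩
    · exact ⟨_, _, _, h1, hx.1, hz.1, hy.1, hxy, hx.2, hz.2, hy.2⟩
  have le3 : ∀ k, #{w ∈ N | K w = k} ≤ 3 := by
    intro k
    by_contra! hk
    obtain ⟨a, b, c, ⟨hab, hbc, hnac⟩, ha, hb, hc, hne, ka, kb, kc⟩ := three k (by omega)
    obtain ⟨x, hx, hxn⟩ := Finset.exists_mem_notMem_of_card_lt_card
      (s := {a, b, c}) (t := {w ∈ N | K w = k}) (lt_of_le_of_lt Finset.card_le_three hk)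
    rw [mem_filter] at hx
    simp only [mem_insert, mem_singleton, not_or] at hxn
    -- The ends `a`, `c` are nonadjacent, so a cherry on `a, c, x` must have middle `x`, and `a b c
    -- x` is a 4-cycle in `F`.
    have := h.exists_cherry hF hG (hmem.1 ha) (hmem.1 hc) (hmem.1 hx.1) hne (Ne.symm hxn.2.2)
      (Ne.symm hxn.1) (ConnectedComponent.eq.1 (ka.trans kc.symm))
      (ConnectedComponent.eq.1 (ka.trans hx.2.symm))
    rcases this with h1 | h1 | h1
    · exact hnac (hF h1.1)
    · exact hnac (hF h1.2.1)
    · exact hac.not_four_cycle hab hbc h1.2.1.symm h1.1.symm hne (Ne.symm hxn.2.1)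
  obtain ⟨k₀, hk₀⟩ : ∃ k₀, ∀ k, #{w ∈ N | K w = k} ≤ 2 + if k = k₀ then 1 else 0 := by
    by_cases hex : ∃ k₀, 2 < #{w ∈ N | K w = k₀}
    · obtain ⟨k₀, hk₀⟩ := hex
      refine ⟨k₀, fun k => ?_⟩
      split_ifs with hkk
      · exact le3 k
      · by_contra! hk
        obtain ⟨a, b, c, h1, ha, hb, hc, hne, ka, kb, kc⟩ := three k₀ hk₀
        obtain ⟨a', b', c', h1', ha', hb', hc', hne', ka', kb', kc'⟩ := three k (by omega)
        refine hkk ?_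
        rw [← ka, ← ka']
        exact ConnectedComponent.eq.2 (h.cherry_reachable hF hG (hmem.1 ha') (hmem.1 hc')
          (hmem.1 ha) (hmem.1 hc) h1' h1 hne' hne)
    · push Not at hex
      -- No component is exceptional, so any choice of `k₀` would do.
      exact ⟨K v, fun k => (hex k).trans (by omega)⟩
  have hmaps : ∀ w ∈ N, K w ∈ univ.erase (K v) := by
    intro w hw
    refine mem_erase.2 ⟨fun he => ?_, mem_univ _⟩
    exact h.not_reachable hF (hmem.1 hw) (ConnectedComponent.eq.1 he.symm)
  have hcard := Finset.card_eq_sum_card_fiberwise hmaps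
  have hsum := Finset.sum_le_sum fun k (_ : k ∈ univ.erase (K v)) => hk₀ k
  rw [← hcard, Finset.sum_add_distrib, Finset.sum_const, Finset.sum_ite_eq',
    Finset.card_erase_of_mem (mem_univ _), Finset.card_univ, smul_eq_mul] at hsum
  have hpos : 0 < Fintype.card F.ConnectedComponent := Fintype.card_pos_iff.2 ⟨K v⟩
  rw [hNc, Nat.card_eq_fintype_card]
  split_ifs at hsum <;> omega

/-! ### Decomposition into 2-regular subgraphs -/

/-- The edge set of a graph with even degrees, all at most `2 * k`, is the union of `k` disjoint
(possibly empty) edge sets of 2-regular graphs. -/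
theorem exists_twoRegular_coloring [Fintype V] (H : SimpleGraph V) (k : ℕ)
    (hH : ∀ v, Even (H.neighborSet v).ncard) (hk : ∀ v, (H.neighborSet v).ncard ≤ 2 * k) :
    ∃ E : Fin k → Set (Sym2 V), (∀ e, e ∈ H.edgeSet ↔ ∃ i, e ∈ E i) ∧
      (∀ e i j, e ∈ E i → e ∈ E j → i = j) ∧
      ∀ i v, (∃ w, s(v, w) ∈ E i) → {w | s(v, w) ∈ E i}.ncard = 2 := by
  classical
  obtain ⟨D, hD1, hD2, hD3⟩ := exists_balanced_orientation H hH
  have hirr : ∀ v, ¬ D v v := fun v h => hD2 v v h h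
  have hout : ∀ v, {w | D v w}.ncard ≤ k := by
    intro v
    have h1 : H.neighborSet v = {w | D v w} ∪ {w | D w v} := by
      ext w; exact hD1 v w
    have h2 := hk v
    have h3 : Disjoint {w | D v w} {w | D w v} := Set.disjoint_left.2 fun w h1 h2 => hD2 _ _ h1 h2
    rw [h1, Set.ncard_union_eq h3 (Set.toFinite _) (Set.toFinite _), ← hD3 v] at h2
    omega
  -- The adjacency matrix of the orientation, padded on the diagonal until every row and column sums
  -- to `k`.
  let m : V → V → ℕ := fun u t =>
    (if D u t then 1 else 0) + if u = t then k - {w | D u w}.ncard else 0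
  obtain ⟨σ, hσ⟩ := exists_perm_of_sum_eq k m
    (fun u => by
      have h := hout u
      simp only [m, Finset.sum_add_distrib, Finset.sum_ite_eq, mem_univ, if_true]
      rw [Finset.sum_boole, Nat.cast_id, ← Set.ncard_coe_finset]
      simp only [coe_filter, mem_univ, true_and]
      omega)
    (fun t => by
      have h := hout t
      simp only [m, Finset.sum_add_distrib, Finset.sum_ite_eq', mem_univ, if_true]
      rw [Finset.sum_boole, Nat.cast_id, ← Set.ncard_coe_finset]
      simp only [coe_filter, mem_univ, true_and]
      rw [hD3 t] at h ⊢
      omega)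
  have hσD : ∀ i u t, σ i u = t → u ≠ t → D u t := by
    intro i u t h hne
    by_contra hn
    have h1 := hσ u t
    simp only [m, hn, hne, if_false, add_zero] at h1
    have := Finset.card_eq_zero.1 h1.symm
    exact Finset.notMem_empty i (this ▸ mem_filter.2 ⟨mem_univ _, h⟩)
  have huniq : ∀ u t, D u t → ∃! i, σ i u = t := by
    intro u t h
    have hne : u ≠ t := by rintro rfl; exact hirr _ h
    have h1 := hσ u t
    simp only [m, h, hne, if_true, if_false, add_zero] at h1
    obtain ⟨i, hi⟩ := Finset.card_eq_one.1 h1.symm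
    refine ⟨i, ?_, fun j hj => ?_⟩
    · have : i ∈ ({i | σ i u = t} : Finset (Fin k)) := by rw [hi]; simp
      exact (mem_filter.1 this).2
    · have : j ∈ ({i | σ i u = t} : Finset (Fin k)) := mem_filter.2 ⟨mem_univ _, hj⟩
      rw [hi] at this
      exact mem_singleton.1 this
  -- Fixed points come from the padding and are discarded. The remaining cycles of `σ i` have length
  -- at least 3, since `D` has no opposite arcs.
  let E : Fin k → Set (Sym2 V) := fun i => {e | ∃ u, σ i u ≠ u ∧ e = s(u, σ i u)}
  have hE : ∀ i u t, s(u, t) ∈ E i ↔ u ≠ t ∧ (σ i u = t ∨ σ i t = u) := by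
    intro i u t
    constructor
    · rintro ⟨x, hx, h⟩
      rcases Sym2.eq_iff.1 h with ⟨rfl, rfl⟩ | ⟨rfl, rfl⟩
      · exact ⟨hx.symm, Or.inl rfl⟩
      · exact ⟨hx, Or.inr rfl⟩
    · rintro ⟨hne, rfl | rfl⟩
      · exact ⟨u, hne.symm, rfl⟩
      · exact ⟨t, hne, Sym2.eq_swap⟩
  refine ⟨E, fun e => ?_, fun e i j => ?_, fun i v => ?_⟩
  · induction e with | _ u t
    rw [mem_edgeSet, hD1]
    simp only [hE]
    constructor
    · rintro (h | h)
      · obtain ⟨i, hi, -⟩ := huniq _ _ h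
        exact ⟨i, by rintro rfl; exact hirr _ h, Or.inl hi⟩
      · obtain ⟨i, hi, -⟩ := huniq _ _ h
        exact ⟨i, by rintro rfl; exact hirr _ h, Or.inr hi⟩
    · rintro ⟨i, hne, h | h⟩
      · exact Or.inl (hσD i _ _ h hne)
      · exact Or.inr (hσD i _ _ h hne.symm)
  · induction e with | _ u t
    rw [hE, hE]
    rintro ⟨hne, h | h⟩ ⟨-, h' | h'⟩
    · exact (huniq _ _ (hσD i _ _ h hne)).unique h h'
    · exact absurd (hσD j _ _ h' hne.symm) (hD2 _ _ (hσD i _ _ h hne))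
    · exact absurd (hσD j _ _ h' hne) (hD2 _ _ (hσD i _ _ h hne.symm))
    · exact (huniq _ _ (hσD i _ _ h hne.symm)).unique h h'
  · rintro ⟨w, hw⟩
    have hv : σ i v ≠ v := by
      obtain ⟨hne, h | h⟩ := (hE _ _ _).1 hw
      · rw [h]; exact hne.symm
      · intro h'; exact hne ((σ i).injective (h'.trans h.symm))
    have hv' : (σ i).symm v ≠ v := by
      intro h; exact hv ((Equiv.symm_apply_eq _).1 h).symm
    have hset : {w | s(v, w) ∈ E i} = {σ i v, (σ i).symm v} := by
      ext w
      simp only [Set.mem_ofPred_eq, hE, Set.mem_insert_iff, Set.mem_singleton_iff,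
        Equiv.eq_symm_apply]
      constructor
      · rintro ⟨-, h | h⟩
        · exact Or.inl h.symm
        · exact Or.inr h
      · rintro (rfl | h)
        · exact ⟨hv.symm, Or.inl rfl⟩
        · refine ⟨?_, Or.inr h⟩
          rintro rfl; exact hv h
    rw [hset]
    refine Set.ncard_pair fun h => ?_
    have h1 := hσD i v _ rfl hv.symm
    have h2 := hσD i ((σ i).symm v) v (by simp) hv'
    rw [h] at h1
    exact hD2 _ _ h1 h2

theorem re_le_of_coloring [Fintype V] (G F : SimpleGraph V) (hF : F ≤ G) (k : ℕ)
    (hH : ∀ v, Even ((G \ F).neighborSet v).ncard)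
    (hk : ∀ v, ((G \ F).neighborSet v).ncard ≤ 2 * k) : G.re ≤ Nat.card F.edgeSet + k := by
  classical
  obtain ⟨E, hE1, hE2, hE3⟩ := exists_twoRegular_coloring (G \ F) k hH hk
  let S : Finset (Set (Sym2 V)) := F.edgeFinset.image (fun e => {e}) ∪ univ.image E
  have hdisj : (S : Set (Set (Sym2 V))).PairwiseDisjoint id := by
    have key : ∀ e i, e ∈ F.edgeSet → e ∈ E i → False := by
      intro e i he hei
      have := (hE1 e).2 ⟨i, hei⟩
      rw [edgeSet_sdiff] at this
      exact this.2 he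
    intro A hA B hB hAB
    simp only [S, coe_union, coe_image, Set.mem_union, Set.mem_image, coe_univ, Set.mem_univ,
      true_and, mem_coe, mem_edgeFinset] at hA hB
    refine Set.disjoint_left.2 fun e heA heB => ?_
    rcases hA with ⟨a, ha, rfl⟩ | ⟨i, rfl⟩ <;> rcases hB with ⟨b, hb, rfl⟩ | ⟨j, rfl⟩
    · refine hAB ?_
      rw [Set.mem_singleton_iff.1 heA.symm, Set.mem_singleton_iff.1 heB.symm]
    · rw [id, Set.mem_singleton_iff] at heA
      exact key a j ha (heA ▸ heB)
    · rw [id, Set.mem_singleton_iff] at heB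
      exact key b i hb (heB ▸ heA)
    · exact hAB (by rw [hE2 e i j heA heB])
  have hsup : S.sup id = G.edgeSet := by
    ext e
    have h1 : e ∈ G.edgeSet ↔ e ∈ F.edgeSet ∨ e ∈ (G \ F).edgeSet := by
      rw [edgeSet_sdiff, Set.mem_sdiff]
      have : e ∈ F.edgeSet → e ∈ G.edgeSet := fun h => edgeSet_mono hF h
      tauto
    rw [h1, hE1]
    simp [S, Finset.sup_eq_iSup, or_and_right, exists_or]
  let P : Finpartition G.edgeSet :=
    -- Some classes `E i` may be empty; erasing the empty set only lowers the number of parts.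
    Finpartition.ofErase S (Finset.supIndep_iff_pairwiseDisjoint.2 hdisj) hsup
  suffices hP : G.IsTwoRegularEdgeDecomposition P by
    have hle : G.re ≤ P.parts.card := Nat.sInf_le ⟨P, hP, rfl⟩
    refine hle.trans ?_
    refine (Finset.card_le_card (Finset.erase_subset _ _)).trans ?_
    refine (Finset.card_union_le _ _).trans (Nat.add_le_add ?_ ?_)
    · refine Finset.card_image_le.trans ?_
      rw [Nat.card_eq_fintype_card, edgeFinset_card]
    · exact Finset.card_image_le.trans (by simp)
  intro A hA
  have hA' := Finset.mem_of_mem_erase hA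
  simp only [S, mem_union, mem_image, mem_univ, true_and] at hA'
  rcases hA' with ⟨e, -, rfl⟩ | ⟨i, rfl⟩
  · exact Or.inr ⟨e, rfl⟩
  · left
    have hG : ∀ v w, s(v, w) ∈ E i → G.Adj v w := by
      intro v w h
      exact ((hE1 s(v, w)).2 ⟨i, h⟩ : (G \ F).Adj v w).1
    rintro v ⟨w, -, hw⟩
    rw [← hE3 i v ⟨w, hw⟩]
    congr 1
    ext w
    exact ⟨fun h => h.2, fun h => ⟨hG v w h, h⟩⟩

/-! ### Existence of a half-bounded subgraph with even complement -/

theorem even_ncard_symmDiff {α : Type*} {s t : Set α} (hs : s.Finite) (ht : t.Finite)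
    (h1 : Even s.ncard) (h2 : Even t.ncard) : Even (symmDiff s t).ncard := by
  have e1 := Set.ncard_inter_add_ncard_sdiff_eq_ncard s t hs
  have e2 := Set.ncard_inter_add_ncard_sdiff_eq_ncard t s ht
  rw [Set.symmDiff_def, Set.ncard_union_eq disjoint_sdiff_sdiff (hs.sdiff) (ht.sdiff)]
  rw [Set.inter_comm] at e2
  rw [Nat.even_iff] at *
  omega

theorem ncard_incidenceSet (H : SimpleGraph V) (v : V) :
    (H.incidenceSet v).ncard = (H.neighborSet v).ncard := by
  classical
  exact Nat.card_congr (H.incidenceSetEquivNeighborSet v)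

/-- For `F` with fewest edges and a closed trail `C`, the symmetric difference of `F` and `C` is
again a candidate, because `C` meets each vertex in an even number of edges. Minimality then gives
`|F ∩ C| ≤ |C \ F|`. -/
theorem exists_isHalfBounded [Fintype V] (G : SimpleGraph V) :
    ∃ F ≤ G, IsHalfBounded G F ∧ ∀ v, Even ((G \ F).neighborSet v).ncard := by
  classical
  obtain ⟨F, ⟨hF, hev⟩, hmin⟩ := Set.exists_min_image
    {F : SimpleGraph V | F ≤ G ∧ ∀ v, Even ((G \ F).neighborSet v).ncard}
    (fun F => F.edgeSet.ncard) (Set.toFinite _) ⟨G, le_rfl, fun v => by simp⟩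
  refine ⟨F, hF, fun u c hc => ?_, hev⟩
  let C : Set (Sym2 V) := {e | e ∈ c.edges}
  have hCG : C ⊆ G.edgeSet := fun e he => c.edges_subset_edgeSet he
  have hFG := edgeSet_mono hF
  have hnd : ∀ e ∈ symmDiff F.edgeSet C, e ∈ G.edgeSet := by
    rintro e (h | h)
    · exact hFG h.1
    · exact hCG h.1
  let F' := fromEdgeSet (symmDiff F.edgeSet C)
  have hF'e : F'.edgeSet = symmDiff F.edgeSet C := by
    rw [edgeSet_fromEdgeSet, sdiff_eq_left, Set.disjoint_left]
    exact fun e he => not_isDiag_of_mem_edgeSet _ (hnd e he)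
  have hF' : F' ≤ G := by
    rw [← edgeSet_subset_edgeSet, hF'e]
    exact hnd
  have hmem : F' ∈ {F : SimpleGraph V | F ≤ G ∧ ∀ v, Even ((G \ F).neighborSet v).ncard} := by
    refine ⟨hF', fun v => ?_⟩
    have hinc : (G \ F').incidenceSet v =
        symmDiff ((G \ F).incidenceSet v) {e | e ∈ C ∧ v ∈ e} := by
      ext e
      simp only [incidenceSet, edgeSet_sdiff, hF'e, Set.mem_ofPred_eq, Set.mem_sdiff,
        Set.mem_symmDiff]
      have h1 := @hCG e
      have h2 := @hFG e
      tauto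
    rw [← ncard_incidenceSet, hinc]
    refine even_ncard_symmDiff (Set.toFinite _) (Set.toFinite _) ?_ ?_
    · rw [ncard_incidenceSet]; exact hev v
    · have : {e | e ∈ C ∧ v ∈ e} = ((c.edges.filter (v ∈ ·)).toFinset : Set (Sym2 V)) := by
        ext e; simp [C]
      rw [this, Set.ncard_coe_finset, List.toFinset_card_of_nodup (hc.edges_nodup.filter _),
        ← List.countP_eq_length_filter, hc.even_countP_edges_iff]
      exact fun h => absurd rfl h
  have hle : F.edgeSet.ncard ≤ F'.edgeSet.ncard := hmin F' hmem
  rw [hF'e, Set.symmDiff_def, Set.ncard_union_eq disjoint_sdiff_sdiff (Set.toFinite _)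
    (Set.toFinite _)] at hle
  have e1 := Set.ncard_inter_add_ncard_sdiff_eq_ncard F.edgeSet C (Set.toFinite _)
  have e2 := Set.ncard_inter_add_ncard_sdiff_eq_ncard C F.edgeSet (Set.toFinite _)
  have e3 : C.ncard = c.length := by
    have : C = (c.edges.toFinset : Set (Sym2 V)) := by ext e; simp [C]
    rw [this, Set.ncard_coe_finset, List.toFinset_card_of_nodup hc.edges_nodup, Walk.length_edges]
  have e4 : {e | e ∈ c.edges ∧ e ∈ F.edgeSet} = C ∩ F.edgeSet := rfl
  rw [Set.inter_comm] at e1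
  rw [e4]
  omega

end SimpleGraph

theorem theorem4 {V : Type*} [Fintype V] [Nonempty V] (G : SimpleGraph V) (hG : G.IsClawFree) :
    G.re ≤ Fintype.card V - 1 := by
  obtain ⟨F, hF, hb, hev⟩ := G.exists_isHalfBounded
  obtain ⟨v, hv⟩ := Finite.exists_max fun v => ((G \ F).neighborSet v).ncard
  obtain ⟨k, hk⟩ := hev v
  have h1 := SimpleGraph.re_le_of_coloring G F hF k hev fun w => (hv w).trans (by omega)
  have h2 := hb.ncard_neighborSet_lt_two_mul_card_connectedComponent hF hG v
  have h3 := (hb.isAcyclic hF).card_edgeSet_add_card_connectedComponent_le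
  -- With `c` components, `h2` reads `2k + 1 ≤ 2c`, hence `k + 1 ≤ c`.
  omega
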